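/- Let $\alpha,\epsilon>0$ be real numbers. Then there is a natural number $N_0=N_0(\alpha,\epsilon)$ such that the following holds. Let $G$ be a finite abelian group of odd order $N>N_0$ and let $A\subseteq G$ satisfy $|A|=\alpha N$. Then there is $d\in G$, $d\neq 0$, such that $A$ contains at least $(\alpha^3-\epsilon)N$ three-term arithmetic progressions with common difference $d$, that is, $$\#\{x\in G : x\in A,\ x+d\in A,\ x+2d\in A\}\ \ge\ (\alpha^3-\epsilon)N .$$ -/

import Mathlib

/-- The number `P(A; d)` of three-term arithmetic progressions `(x, x + d, x + 2d)` with common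
difference `d` all of whose terms lie in `A`. A progression is an ordered triple, so it is
counted once for each first term `x`. -/
def numThreeAP {G : Type*} [AddCommGroup G] [DecidableEq G] (A : Finset G) (d : G) : ℕ :=
  (A.filter (fun x => x + d ∈ A ∧ x + 2 • d ∈ A)).card

/-! Average the progression count over `d` against a probability density `W` on `G` whose value at 0
is bounded independently of `G`. The difference `d = 0` then carries weight O(1/N), so it suffices
that the weighted count of the indicator f of A is at least α³ - ε/2.

If f were almost invariant under the shifts favoured by `W`, the count would be about 𝔼 f³, which is
at least α³ by convexity. In general f is first smoothed, using Fejér-type kernels β, `W`, β' at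
successively finer scales. Passing from f to f * β' changes every Fourier coefficient by much less
than 1/`W 0`, which the weighted count does not notice (`abs_weightedAP_le`; odd order enters here).
Passing from f * β' to f * β is cheap in L² for a suitable choice of scales, by pigeonholing a
bounded energy (`exists_sum_mul_sq_sub_le`). Finally f * β is almost invariant under shifts weighted
by `W`, since the coefficients of `W` are near 1 wherever those of β are not small.
`cube_expect_sub_le_weightedAP` combines the three comparisons. -/

open Finset
open scoped BigOperators ComplexConjugate

/-! ### Fourier analysis on a finite abelian group -/

section Fourier

variable {G : Type*} [AddCommGroup G] [Fintype G]

/-- The normalised Fourier coefficient of `f` at the character `ψ`. -/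
noncomputable def fourierCoef (f : G → ℂ) (ψ : AddChar G ℂ) : ℂ := 𝔼 x, f x * ψ (-x)

/-- The normalised convolution of two functions on a finite abelian group. -/
noncomputable def expectConv (f g : G → ℝ) (x : G) : ℝ := 𝔼 y, f (x - y) * g y

lemma expect_translate {M : Type*} [AddCommMonoid M] [Module ℚ≥0 M] (f : G → M) (a : G) :
    𝔼 x, f (x + a) = 𝔼 x, f x :=
  Fintype.expect_equiv (Equiv.addRight a) _ _ fun _ => rfl

lemma fourierCoef_inversion (f : G → ℂ) (x : G) : ∑ ψ, fourierCoef f ψ * ψ x = f x := by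
  classical
  have h : ∀ ψ : AddChar G ℂ, fourierCoef f ψ * ψ x = 𝔼 y, f y * ψ (x - y) := by
    intro ψ
    rw [fourierCoef, expect_mul]
    refine expect_congr rfl fun y _ => ?_
    rw [sub_eq_neg_add, AddChar.map_add_eq_mul, mul_assoc]
  simp_rw [h]
  rw [← expect_sum_comm]
  simp_rw [← mul_sum, AddChar.sum_apply_eq_ite, sub_eq_zero, mul_ite, mul_zero]
  have hN : (Fintype.card G : ℂ) ≠ 0 := by simp
  rw [Fintype.expect_eq_sum_div_card, sum_ite_eq]
  simp [hN]

lemma sum_norm_sq_fourierCoef (f : G → ℂ) :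
    ∑ ψ, ‖fourierCoef f ψ‖ ^ 2 = 𝔼 x, ‖f x‖ ^ 2 := by
  have key : ∑ ψ, fourierCoef f ψ * conj (fourierCoef f ψ) = 𝔼 x, f x * conj (f x) := by
    have h : ∀ ψ : AddChar G ℂ, conj (fourierCoef f ψ) = 𝔼 x, conj (f x) * ψ x := by
      intro ψ
      simp_rw [fourierCoef, Fintype.expect_eq_sum_div_card]
      simp [AddChar.map_neg_eq_conj]
    simp_rw [h, mul_expect]
    rw [← expect_sum_comm]
    refine expect_congr rfl fun x _ => ?_
    nth_rewrite 2 [← fourierCoef_inversion f x]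
    rw [sum_mul]
    exact sum_congr rfl fun ψ _ => by ring
  simp_rw [Complex.mul_conj, Complex.normSq_eq_norm_sq] at key
  exact_mod_cast key

lemma norm_expect_le' (f : G → ℂ) : ‖𝔼 x, f x‖ ≤ 𝔼 x, ‖f x‖ := by
  rw [Fintype.expect_eq_sum_div_card, Fintype.expect_eq_sum_div_card, norm_div, Complex.norm_natCast]
  gcongr
  exact norm_sum_le _ _

lemma expect_le_one {f : G → ℝ} (hf : ∀ x, f x ≤ 1) : 𝔼 x, f x ≤ 1 := by
  refine (expect_le_expect fun x _ => hf x).trans_eq ?_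
  simp

lemma sum_norm_sq_fourierCoef_le_one {f : G → ℂ} (hf : ∀ x, ‖f x‖ ≤ 1) :
    ∑ ψ, ‖fourierCoef f ψ‖ ^ 2 ≤ 1 := by
  rw [sum_norm_sq_fourierCoef]
  exact expect_le_one fun x => pow_le_one₀ (norm_nonneg _) (hf x)

lemma norm_fourierCoef_le (f : G → ℂ) (ψ : AddChar G ℂ) :
    ‖fourierCoef f ψ‖ ≤ 𝔼 x, ‖f x‖ := by
  refine (norm_expect_le' _).trans_eq (expect_congr rfl fun x _ => ?_)
  rw [norm_mul, AddChar.norm_apply, mul_one]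

lemma norm_fourierCoef_le_one {f : G → ℂ} (hf : ∀ x, ‖f x‖ ≤ 1) (ψ : AddChar G ℂ) :
    ‖fourierCoef f ψ‖ ≤ 1 :=
  (norm_fourierCoef_le f ψ).trans (expect_le_one hf)

lemma fourierCoef_expectConv (f g : G → ℝ) (ψ : AddChar G ℂ) :
    fourierCoef (fun x => (expectConv f g x : ℂ)) ψ =
      fourierCoef (fun x => (f x : ℂ)) ψ * fourierCoef (fun x => (g x : ℂ)) ψ := by
  have h1 : ∀ x, (expectConv f g x : ℂ) * ψ (-x)
      = 𝔼 y, ((f (x - y) : ℂ) * ψ (-(x - y))) * (g y * ψ (-y)) := by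
    intro x
    rw [expectConv, Complex.ofReal_expect, expect_mul]
    refine expect_congr rfl fun y _ => ?_
    rw [show -x = -(x - y) + -y by abel, AddChar.map_add_eq_mul]
    push_cast
    ring
  rw [fourierCoef]
  simp_rw [h1]
  rw [expect_comm]
  simp_rw [← expect_mul]
  rw [fourierCoef, fourierCoef, mul_expect]
  refine expect_congr rfl fun y _ => ?_
  congr 1
  have := expect_translate (fun x => (f x : ℂ) * ψ (-x)) (-y)
  simpa only [sub_eq_add_neg] using this

lemma fourierCoef_mul_addChar (f : G → ℂ) (χ ψ : AddChar G ℂ) :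
    fourierCoef (fun x => f x * χ x) ψ = fourierCoef f (ψ - χ) := by
  refine expect_congr rfl fun x _ => ?_
  rw [AddChar.sub_apply, neg_neg]
  ring

lemma fourierCoef_translate (f : G → ℂ) (a : G) (ψ : AddChar G ℂ) :
    fourierCoef (fun x => f (x + a)) ψ = fourierCoef f ψ * ψ a := by
  rw [fourierCoef, ← expect_translate _ (-a), fourierCoef, expect_mul]
  refine expect_congr rfl fun x _ => ?_
  rw [neg_add_cancel_right, neg_add, neg_neg, AddChar.map_add_eq_mul, mul_assoc]

lemma fourierCoef_sub (f g : G → ℂ) (ψ : AddChar G ℂ) :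
    fourierCoef (fun x => f x - g x) ψ = fourierCoef f ψ - fourierCoef g ψ := by
  simp_rw [fourierCoef, ← expect_sub_distrib, sub_mul]

/-- The Fourier expansion of the average of `f x * g (x + d) * h (x + 2d)`. -/
lemma expect_threeAP_eq (f g h : G → ℂ) :
    𝔼 d, 𝔼 x, f x * g (x + d) * h (x + 2 • d) =
      ∑ ψ, fourierCoef f ψ * fourierCoef g (-(2 • ψ)) * fourierCoef h ψ := by
  have h1 : ∀ d x, f x * g (x + d) * h (x + 2 • d) = ∑ ψ : AddChar G ℂ,
      fourierCoef h ψ * ((f x * ψ (-x)) * (g (x + d) * (-(2 • ψ)) (-(x + d)))) := by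
    intro d x
    rw [← fourierCoef_inversion h (x + 2 • d), mul_sum]
    refine sum_congr rfl fun ψ _ => ?_
    -- The relation x + 2d = -x + 2(x + d) among the terms of a progression.
    have : ψ (x + 2 • d) = ψ (-x) * (-(2 • ψ)) (-(x + d)) := by
      rw [AddChar.neg_apply, neg_neg, AddChar.nsmul_apply, ← AddChar.map_nsmul_eq_pow,
        ← AddChar.map_add_eq_mul]
      congr 1
      rw [two_nsmul, two_nsmul]
      abel
    rw [this]
    ring
  simp_rw [h1, expect_sum_comm]
  refine sum_congr rfl fun ψ _ => ?_
  rw [expect_comm]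
  simp_rw [← mul_expect]
  have h2 : ∀ x, 𝔼 d, g (x + d) * (-(2 • ψ)) (-(x + d)) = fourierCoef g (-(2 • ψ)) := by
    intro x
    have := expect_translate (fun d => g d * (-(2 • ψ)) (-d)) x
    simp_rw [add_comm x]
    exact this
  simp_rw [h2, ← expect_mul]
  rw [← fourierCoef]
  ring

end Fourier

/-! ### Products of Fejér-type factors -/

section FejerProd

variable {G : Type*} [AddCommGroup G]

/-- The Fejér-type factor attached to a character. -/
noncomputable def fejerFactor (L : ℕ) (γ : AddChar G ℂ) (x : G) : ℝ :=
  ‖∑ n ∈ range L, γ x ^ n‖ ^ 2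

/-- The product of the Fejér-type factors over a finite set of characters. -/
noncomputable def fejerProd (L : ℕ) (S : Finset (AddChar G ℂ)) (x : G) : ℝ :=
  ∏ γ ∈ S, fejerFactor L γ x

lemma fejerProd_nonneg (L : ℕ) (S : Finset (AddChar G ℂ)) (x : G) : 0 ≤ fejerProd L S x :=
  prod_nonneg fun _ _ => sq_nonneg _

lemma fejerProd_zero (L : ℕ) (S : Finset (AddChar G ℂ)) :
    fejerProd L S (0 : G) = (L : ℝ) ^ (2 * #S) := by
  simp [fejerProd, fejerFactor, pow_mul]

lemma fejerProd_insert [DecidableEq (AddChar G ℂ)] (L : ℕ) {S : Finset (AddChar G ℂ)}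
    {γ : AddChar G ℂ} (hγ : γ ∉ S) (x : G) :
    fejerProd L (insert γ S) x = fejerProd L S x * fejerFactor L γ x := by
  rw [fejerProd, prod_insert hγ, mul_comm, fejerProd]

end FejerProd

/-! ### Kernels with nonnegative Fourier coefficients -/

section Kernel

open scoped ComplexOrder

variable {G : Type*} [AddCommGroup G] [Fintype G]

/-- A probability density `β` on `G` whose Fourier coefficients `b` are real and nonnegative. -/
structure IsFourierKernel (β : G → ℝ) (b : AddChar G ℂ → ℝ) : Prop where
  nonneg : ∀ x, 0 ≤ β x
  expect_eq_one : 𝔼 x, β x = 1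
  coef_nonneg : ∀ ψ, 0 ≤ b ψ
  fourierCoef_eq : ∀ ψ, fourierCoef (fun x => (β x : ℂ)) ψ = b ψ

lemma IsFourierKernel.coef_le_one {β : G → ℝ} {b : AddChar G ℂ → ℝ} (h : IsFourierKernel β b)
    (ψ : AddChar G ℂ) : b ψ ≤ 1 := by
  have h1 := norm_fourierCoef_le (fun x => (β x : ℂ)) ψ
  rw [h.fourierCoef_eq, Complex.norm_of_nonneg (h.coef_nonneg ψ)] at h1
  refine h1.trans_eq ?_
  rw [← h.expect_eq_one]
  exact expect_congr rfl fun x _ => Complex.norm_of_nonneg (h.nonneg x)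

lemma IsFourierKernel.sum_coef_mul {β : G → ℝ} {b : AddChar G ℂ → ℝ} (h : IsFourierKernel β b)
    (x : G) : ∑ ψ, (b ψ : ℂ) * ψ x = β x := by
  simp_rw [← h.fourierCoef_eq]
  exact fourierCoef_inversion (fun x => (β x : ℂ)) x

lemma IsFourierKernel.sum_coef {β : G → ℝ} {b : AddChar G ℂ → ℝ} (h : IsFourierKernel β b) :
    ∑ ψ, b ψ = β 0 := by
  have := h.sum_coef_mul 0
  simp only [AddChar.map_zero_eq_one, mul_one] at this
  exact_mod_cast this

lemma isFourierKernel_one [DecidableEq (AddChar G ℂ)] :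
    IsFourierKernel (fun _ : G => 1) (fun ψ => if ψ = 0 then 1 else 0) where
  nonneg _ := zero_le_one
  expect_eq_one := by simp
  coef_nonneg ψ := by split_ifs <;> norm_num
  fourierCoef_eq ψ := by
    simp only [fourierCoef, Complex.ofReal_one, one_mul]
    have := AddChar.expect_eq_ite (-ψ)
    simp only [AddChar.neg_apply, neg_eq_zero] at this
    rw [this]
    split_ifs <;> simp

lemma fejerFactor_eq (L : ℕ) (γ : AddChar G ℂ) (x : G) :
    (fejerFactor L γ x : ℂ) = ∑ n ∈ range L, ∑ m ∈ range L, (n • γ - m • γ) x := by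
  rw [fejerFactor, ← Complex.normSq_eq_norm_sq, ← Complex.mul_conj, map_sum, sum_mul_sum]
  refine sum_congr rfl fun n _ => sum_congr rfl fun m _ => ?_
  rw [AddChar.sub_apply, AddChar.map_neg_eq_conj, AddChar.nsmul_apply, AddChar.nsmul_apply]

lemma fourierCoef_mul_fejerFactor (L : ℕ) (γ : AddChar G ℂ) (f : G → ℂ) (ψ : AddChar G ℂ) :
    fourierCoef (fun x => f x * fejerFactor L γ x) ψ =
      ∑ n ∈ range L, ∑ m ∈ range L, fourierCoef f (ψ - (n • γ - m • γ)) := by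
  simp_rw [fejerFactor_eq, ← fourierCoef_mul_addChar, fourierCoef, ← expect_sum_comm, mul_sum,
    sum_mul]

lemma fourierCoef_mul_fejerFactor_nonneg (L : ℕ) (γ : AddChar G ℂ) {f : G → ℂ}
    (hf : ∀ ψ, 0 ≤ fourierCoef f ψ) (ψ : AddChar G ℂ) :
    0 ≤ fourierCoef (fun x => f x * fejerFactor L γ x) ψ := by
  rw [fourierCoef_mul_fejerFactor]
  exact sum_nonneg fun _ _ => sum_nonneg fun _ _ => hf _

/-- All terms of the double sum are nonnegative, so only the diagonal n = m is kept. -/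
lemma le_fourierCoef_mul_fejerFactor (L : ℕ) (γ : AddChar G ℂ) {f : G → ℂ}
    (hf : ∀ ψ, 0 ≤ fourierCoef f ψ) :
    (L : ℂ) * fourierCoef f 0 ≤ fourierCoef (fun x => f x * fejerFactor L γ x) 0 := by
  rw [fourierCoef_mul_fejerFactor]
  calc (L : ℂ) * fourierCoef f 0 = ∑ n ∈ range L, fourierCoef f (0 - (n • γ - n • γ)) := by simp
    _ ≤ _ := sum_le_sum fun n hn =>
      single_le_sum (f := fun m => fourierCoef f (0 - (n • γ - m • γ))) (fun _ _ => hf _) hn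

lemma fourierCoef_fejerProd_nonneg (L : ℕ) (S : Finset (AddChar G ℂ)) (ψ : AddChar G ℂ) :
    0 ≤ fourierCoef (fun x => (fejerProd L S x : ℂ)) ψ := by
  classical
  induction S using Finset.induction_on generalizing ψ with
  | empty =>
    have h := (isFourierKernel_one (G := G)).fourierCoef_eq ψ
    simp only [fejerProd, prod_empty]
    rw [h]
    exact_mod_cast (isFourierKernel_one (G := G)).coef_nonneg ψ
  | insert γ S hγ ih =>
    simp_rw [fejerProd_insert L hγ, Complex.ofReal_mul]
    exact fourierCoef_mul_fejerFactor_nonneg L γ ih ψ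

lemma fourierCoef_ofReal_zero (f : G → ℝ) :
    fourierCoef (fun x => (f x : ℂ)) 0 = ((𝔼 x, f x : ℝ) : ℂ) := by
  simp [fourierCoef, Complex.ofReal_expect]

lemma mul_expect_fejerProd_le [DecidableEq (AddChar G ℂ)] (L : ℕ) {S : Finset (AddChar G ℂ)}
    {γ : AddChar G ℂ} (hγ : γ ∉ S) :
    L * 𝔼 x, fejerProd L S x ≤ 𝔼 x, fejerProd L (insert γ S) x := by
  have h := le_fourierCoef_mul_fejerFactor L γ (fourierCoef_fejerProd_nonneg L S)
  simp_rw [← Complex.ofReal_mul, ← fejerProd_insert L hγ, fourierCoef_ofReal_zero] at h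
  exact_mod_cast h

lemma one_le_expect_fejerProd {L : ℕ} (hL : 1 ≤ L) (S : Finset (AddChar G ℂ)) :
    1 ≤ 𝔼 x, fejerProd L S x := by
  classical
  induction S using Finset.induction_on with
  | empty => simp [fejerProd]
  | insert γ S hγ ih =>
    have hL' : (1 : ℝ) ≤ L := by exact_mod_cast hL
    refine le_trans ?_ (mul_expect_fejerProd_le L hγ)
    nlinarith

/-- The geometric sum collapses to 1 - γ(x)^L, of norm at most 2. -/
lemma norm_one_sub_sq_mul_fejerFactor_le (L : ℕ) (γ : AddChar G ℂ) (x : G) :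
    ‖1 - γ x‖ ^ 2 * fejerFactor L γ x ≤ 4 := by
  have h : (1 - γ x) * ∑ n ∈ range L, γ x ^ n = 1 - γ x ^ L := by
    rw [mul_comm, geom_sum_mul_neg]
  rw [fejerFactor, ← mul_pow, ← norm_mul, h]
  have : ‖1 - γ x ^ L‖ ≤ 2 := by
    refine (norm_sub_le _ _).trans ?_
    rw [norm_pow, AddChar.norm_apply]
    norm_num
  nlinarith [norm_nonneg (1 - γ x ^ L)]

lemma norm_one_sub_addChar_sq (γ : AddChar G ℂ) (x : G) :
    ‖1 - γ x‖ ^ 2 = 2 - 2 * (γ (-x)).re := by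
  have h := AddChar.norm_apply γ x
  have h2 : (γ x).re ^ 2 + (γ x).im ^ 2 = 1 := by
    have := Complex.sq_norm (γ x)
    rw [h, Complex.normSq_apply] at this
    linarith
  rw [Complex.sq_norm, Complex.normSq_apply, AddChar.map_neg_eq_conj, Complex.conj_re]
  simp only [Complex.sub_re, Complex.sub_im, Complex.one_re, Complex.one_im]
  linarith

lemma expect_mul_norm_one_sub_sq (f : G → ℝ) (γ : AddChar G ℂ) :
    𝔼 x, f x * ‖1 - γ x‖ ^ 2 =
      2 * 𝔼 x, f x - 2 * (fourierCoef (fun x => (f x : ℂ)) γ).re := by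
  have : (fourierCoef (fun x => (f x : ℂ)) γ).re = 𝔼 x, f x * (γ (-x)).re := by
    rw [fourierCoef, Fintype.expect_eq_sum_div_card, Fintype.expect_eq_sum_div_card,
      Complex.div_natCast_re, Complex.re_sum]
    simp
  rw [this, mul_expect, mul_expect, ← expect_sub_distrib]
  refine expect_congr rfl fun x _ => ?_
  rw [norm_one_sub_addChar_sq]
  ring

/-- The factor of γ multiplies the mean by at least L, yet its product with |1 - γ|² stays below 4.
Hence |1 - γ|² has mean at most 4/L under the normalised product, and this mean is twice the defect
of the coefficient at γ from 1. -/
lemma expect_fejerProd_sub_le {L : ℕ} {S : Finset (AddChar G ℂ)} {γ : AddChar G ℂ} (hγ : γ ∈ S) :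
    L * (𝔼 x, fejerProd L S x - (fourierCoef (fun x => (fejerProd L S x : ℂ)) γ).re) ≤
      2 * 𝔼 x, fejerProd L S x := by
  classical
  have h1 := expect_mul_norm_one_sub_sq (fejerProd L S) γ
  have h2 := mul_expect_fejerProd_le L (notMem_erase γ S)
  have h3 : 𝔼 x, fejerProd L S x * ‖1 - γ x‖ ^ 2 ≤ 4 * 𝔼 x, fejerProd L (S.erase γ) x := by
    rw [mul_expect]
    refine expect_le_expect fun x _ => ?_
    rw [← insert_erase hγ, fejerProd_insert L (notMem_erase γ S), erase_insert (notMem_erase γ S)]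
    have h4 := norm_one_sub_sq_mul_fejerFactor_le L γ x
    nlinarith [fejerProd_nonneg L (S.erase γ) x]
  rw [insert_erase hγ] at h2
  have hL : (0 : ℝ) ≤ L := Nat.cast_nonneg L
  nlinarith

lemma exists_isFourierKernel {L : ℕ} (hL : 1 ≤ L) (S : Finset (AddChar G ℂ)) :
    ∃ (β : G → ℝ) (b : AddChar G ℂ → ℝ), IsFourierKernel β b ∧ β 0 ≤ (L : ℝ) ^ (2 * #S) ∧
      ∀ γ ∈ S, 1 - 2 / (L : ℝ) ≤ b γ := by
  set E : ℝ := 𝔼 x, fejerProd L S x with hE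
  have hE1 : 1 ≤ E := one_le_expect_fejerProd hL S
  have hE0 : 0 < E := by linarith
  have hL0 : (0 : ℝ) < L := by exact_mod_cast hL
  refine ⟨fun x => fejerProd L S x / E,
    fun ψ => (fourierCoef (fun x => (fejerProd L S x : ℂ)) ψ).re / E, ⟨?_, ?_, ?_, ?_⟩, ?_, ?_⟩
  · exact fun x => div_nonneg (fejerProd_nonneg L S x) hE0.le
  · rw [← expect_div, ← hE, div_self hE0.ne']
  · exact fun ψ => div_nonneg (Complex.le_def.1 (fourierCoef_fejerProd_nonneg L S ψ)).1 hE0.le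
  · intro ψ
    have h := (Complex.le_def.1 (fourierCoef_fejerProd_nonneg L S ψ)).2
    have h' : ((fourierCoef (fun x => (fejerProd L S x : ℂ)) ψ).re : ℂ)
        = fourierCoef (fun x => (fejerProd L S x : ℂ)) ψ := Complex.ext (by simp) (by simpa using h)
    rw [Complex.ofReal_div, h', fourierCoef, fourierCoef, expect_div]
    refine expect_congr rfl fun x _ => ?_
    push_cast
    ring
  · change fejerProd L S 0 / E ≤ _
    rw [fejerProd_zero]
    exact div_le_self (by positivity) hE1
  · intro γ hγ
    have h := expect_fejerProd_sub_le (L := L) hγ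
    rw [le_div_iff₀ hE0, sub_mul, div_mul_eq_mul_div, one_mul, sub_le_comm, le_div_iff₀ hL0]
    linarith

end Kernel

lemma expect_mul_expect_mono {ι κ : Type*} [Fintype ι] [Fintype κ] {W : ι → ℝ}
    (hW : ∀ d, 0 ≤ W d) {F H : ι → κ → ℝ} (h : ∀ d x, F d x ≤ H d x) :
    𝔼 d, W d * 𝔼 x, F d x ≤ 𝔼 d, W d * 𝔼 x, H d x :=
  expect_le_expect fun d _ =>
    mul_le_mul_of_nonneg_left (expect_le_expect fun x _ => h d x) (hW d)

/-! ### Weighted counts of progressions and their stability -/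

section ThreeAP

variable {G : Type*} [AddCommGroup G] [Fintype G]

lemma sum_norm_mul_mul_le {ι : Type*} [Fintype ι] {u v w : ι → ℂ} {η : ℝ} (hη : 0 ≤ η)
    (hu : ∀ i, ‖u i‖ ≤ η) (hv : ∑ i, ‖v i‖ ^ 2 ≤ 1) (hw : ∑ i, ‖w i‖ ^ 2 ≤ 1) :
    ∑ i, ‖u i‖ * (‖v i‖ * ‖w i‖) ≤ η := by
  calc ∑ i, ‖u i‖ * (‖v i‖ * ‖w i‖) ≤ ∑ i, η * ((‖v i‖ ^ 2 + ‖w i‖ ^ 2) / 2) := by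
        refine sum_le_sum fun i _ => mul_le_mul (hu i) ?_ (by positivity) hη
        nlinarith [sq_nonneg (‖v i‖ - ‖w i‖)]
    _ = η * ((∑ i, ‖v i‖ ^ 2 + ∑ i, ‖w i‖ ^ 2) / 2) := by
        rw [← mul_sum, ← sum_div, sum_add_distrib]
    _ ≤ η * 1 := by gcongr; linarith
    _ = η := mul_one η

/-- The dual group also has odd order, so doubling permutes it. -/
lemma sum_norm_sq_comp_neg_two_nsmul (hG : Odd (Fintype.card G)) (u : AddChar G ℂ → ℂ) :
    ∑ ψ, ‖u (-(2 • ψ))‖ ^ 2 = ∑ ψ, ‖u ψ‖ ^ 2 := by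
  have hcop : (Nat.card (AddChar G ℂ)).Coprime 2 := by
    rw [Nat.card_eq_fintype_card, AddChar.card_eq]
    exact Nat.coprime_two_right.2 hG
  exact Fintype.sum_equiv ((nsmulCoprime hcop).trans (Equiv.neg _)) _ _ fun _ => rfl

lemma norm_expect_threeAP_le (hG : Odd (Fintype.card G)) {f g h : G → ℂ} {η : ℝ} (hη : 0 ≤ η)
    (hf : ∀ x, ‖f x‖ ≤ 1) (hg : ∀ x, ‖g x‖ ≤ 1) (hh : ∀ x, ‖h x‖ ≤ 1)
    (H : (∀ ψ, ‖fourierCoef f ψ‖ ≤ η) ∨ (∀ ψ, ‖fourierCoef g ψ‖ ≤ η) ∨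
      (∀ ψ, ‖fourierCoef h ψ‖ ≤ η)) :
    ‖𝔼 d, 𝔼 x, f x * g (x + d) * h (x + 2 • d)‖ ≤ η := by
  rw [expect_threeAP_eq]
  refine (norm_sum_le _ _).trans ?_
  simp_rw [norm_mul]
  have hF := sum_norm_sq_fourierCoef_le_one hf
  have hH := sum_norm_sq_fourierCoef_le_one hh
  have hGG : ∑ ψ : AddChar G ℂ, ‖fourierCoef g (-(2 • ψ))‖ ^ 2 ≤ 1 :=
    (sum_norm_sq_comp_neg_two_nsmul hG _).trans_le (sum_norm_sq_fourierCoef_le_one hg)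
  rcases H with H | H | H
  · refine le_trans (le_of_eq (sum_congr rfl fun ψ _ => ?_)) (sum_norm_mul_mul_le hη H hGG hH)
    ring
  · refine le_trans (le_of_eq (sum_congr rfl fun ψ _ => ?_))
      (sum_norm_mul_mul_le hη (fun ψ => H (-(2 • ψ))) hF hH)
    ring
  · refine le_trans (le_of_eq (sum_congr rfl fun ψ _ => ?_)) (sum_norm_mul_mul_le hη H hF hGG)
    ring

/-- The average of `f x * g (x + d) * h (x + 2d)`, where `d` carries the weight `W d`. -/
noncomputable def weightedAP (W f g h : G → ℝ) : ℝ :=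
  𝔼 d, W d * 𝔼 x, f x * g (x + d) * h (x + 2 • d)

/-- Expand `W` in characters. Since ψ(d) = ψ(-x) ψ(x + d), each character is absorbed into f and g,
which merely translates their Fourier coefficients. The unweighted bound η then applies termwise,
and the coefficients of `W` sum to `W 0`. -/
lemma abs_weightedAP_le (hG : Odd (Fintype.card G)) {W : G → ℝ} {w : AddChar G ℂ → ℝ}
    (hW : IsFourierKernel W w) {f g h : G → ℝ} {η : ℝ} (hη : 0 ≤ η)
    (hf : ∀ x, |f x| ≤ 1) (hg : ∀ x, |g x| ≤ 1) (hh : ∀ x, |h x| ≤ 1)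
    (H : (∀ ψ, ‖fourierCoef (fun x => (f x : ℂ)) ψ‖ ≤ η) ∨
      (∀ ψ, ‖fourierCoef (fun x => (g x : ℂ)) ψ‖ ≤ η) ∨
      (∀ ψ, ‖fourierCoef (fun x => (h x : ℂ)) ψ‖ ≤ η)) :
    |weightedAP W f g h| ≤ W 0 * η := by
  have key : ((weightedAP W f g h : ℝ) : ℂ) = ∑ ψ, (w ψ : ℂ) * 𝔼 d, 𝔼 x,
      ((f x : ℂ) * (-ψ) x) * ((g (x + d) : ℂ) * ψ (x + d)) * (h (x + 2 • d) : ℂ) := by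
    simp_rw [weightedAP, Complex.ofReal_expect, Complex.ofReal_mul, Complex.ofReal_expect,
      ← hW.sum_coef_mul, sum_mul, expect_sum_comm]
    refine sum_congr rfl fun ψ _ => ?_
    rw [mul_expect]
    refine expect_congr rfl fun d _ => ?_
    rw [mul_assoc, mul_expect]
    congr 1
    refine expect_congr rfl fun x _ => ?_
    have : ψ d = (-ψ) x * ψ (x + d) := by
      rw [AddChar.neg_apply, ← AddChar.map_add_eq_mul, neg_add_cancel_left]
    rw [this]
    push_cast
    ring
  rw [← Real.norm_eq_abs, ← Complex.norm_real, key, ← hW.sum_coef, sum_mul]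
  refine (norm_sum_le _ _).trans (sum_le_sum fun ψ _ => ?_)
  rw [norm_mul, Complex.norm_of_nonneg (hW.coef_nonneg ψ)]
  refine mul_le_mul_of_nonneg_left ?_ (hW.coef_nonneg ψ)
  refine norm_expect_threeAP_le hG (f := fun x => (f x : ℂ) * (-ψ) x)
    (g := fun x => (g x : ℂ) * ψ x) (h := fun x => (h x : ℂ)) hη ?_ ?_ ?_ ?_
  · intro x
    simpa [AddChar.norm_apply] using hf x
  · intro x
    simpa [AddChar.norm_apply] using hg x
  · intro x
    simpa using hh x
  · simp_rw [fourierCoef_mul_addChar]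
    exact H.imp (fun H _ => H _) (Or.imp (fun H _ => H _) id)

lemma sub_abs_le_mul_mul {a b c a' b' c' : ℝ} (hb : b ∈ Set.Icc (0 : ℝ) 1)
    (hc : c ∈ Set.Icc (0 : ℝ) 1) (ha' : a' ∈ Set.Icc (0 : ℝ) 1) (hb' : b' ∈ Set.Icc (0 : ℝ) 1) :
    a' * b' * c' - (|a - a'| + |b - b'| + |c - c'|) ≤ a * b * c := by
  have e : a * b * c - a' * b' * c' =
      (a - a') * (b * c) + (b - b') * (a' * c) + (c - c') * (a' * b') := by ring
  have aux : ∀ {s p q : ℝ}, p ∈ Set.Icc (0 : ℝ) 1 → q ∈ Set.Icc (0 : ℝ) 1 →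
      -|s| ≤ s * (p * q) := by
    intro s p q hp hq
    have h0 : 0 ≤ p * q := mul_nonneg hp.1 hq.1
    have h1 : p * q ≤ 1 := mul_le_one₀ hp.2 hq.1 hq.2
    calc -|s| ≤ -|s| * (p * q) := by nlinarith [abs_nonneg s]
      _ ≤ s * (p * q) := mul_le_mul_of_nonneg_right (neg_abs_le s) h0
  have h1 := aux (s := a - a') hb hc
  have h2 := aux (s := b - b') ha' hc
  have h3 := aux (s := c - c') ha' hb'
  linarith

lemma weightedAP_sub_le_of_L1 {W : G → ℝ} {w : AddChar G ℂ → ℝ} (hW : IsFourierKernel W w)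
    {f g : G → ℝ} (hf : ∀ x, f x ∈ Set.Icc (0 : ℝ) 1) (hg : ∀ x, g x ∈ Set.Icc (0 : ℝ) 1) :
    weightedAP W f f f - 3 * 𝔼 x, |g x - f x| ≤ weightedAP W g g g := by
  have h1 := expect_mul_expect_mono hW.nonneg fun d x =>
    sub_abs_le_mul_mul (a := g x) (c' := f (x + 2 • d)) (hg (x + d)) (hg (x + 2 • d)) (hf x)
      (hf (x + d))
  refine le_trans (le_of_eq ?_) h1
  have h2 : ∀ d, 𝔼 x, (f x * f (x + d) * f (x + 2 • d) -
      (|g x - f x| + |g (x + d) - f (x + d)| + |g (x + 2 • d) - f (x + 2 • d)|)) =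
      𝔼 x, f x * f (x + d) * f (x + 2 • d) - 3 * 𝔼 x, |g x - f x| := by
    intro d
    rw [expect_sub_distrib, expect_add_distrib, expect_add_distrib,
      expect_translate (fun x => |g x - f x|), expect_translate (fun x => |g x - f x|)]
    ring
  simp_rw [h2, mul_sub, expect_sub_distrib, ← expect_mul]
  rw [hW.expect_eq_one, one_mul, weightedAP]

lemma le_weightedAP_of_translate {W : G → ℝ} {w : AddChar G ℂ → ℝ} (hW : IsFourierKernel W w)
    {f : G → ℝ} (hf : ∀ x, f x ∈ Set.Icc (0 : ℝ) 1) :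
    𝔼 x, f x ^ 3 - 3 * 𝔼 d, W d * 𝔼 x, |f (x + d) - f x| ≤ weightedAP W f f f := by
  have h1 := expect_mul_expect_mono hW.nonneg (F := fun d x => f x ^ 3 -
      (2 * |f (x + d) - f x| + |f (x + 2 • d) - f (x + d)|))
      (H := fun d x => f x * f (x + d) * f (x + 2 • d)) fun d x => by
    have h := sub_abs_le_mul_mul (a := f x) (c' := f x) (hf (x + d)) (hf (x + 2 • d)) (hf x) (hf x)
    have h' := abs_sub_le (f (x + 2 • d)) (f (x + d)) (f x)
    rw [sub_self, abs_zero] at h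
    refine le_trans ?_ h
    have : f x ^ 3 = f x * f x * f x := by ring
    linarith
  refine le_trans (le_of_eq ?_) h1
  have h2 : ∀ d, 𝔼 x, (f x ^ 3 - (2 * |f (x + d) - f x| + |f (x + 2 • d) - f (x + d)|)) =
      𝔼 x, f x ^ 3 - 3 * 𝔼 x, |f (x + d) - f x| := by
    intro d
    have := expect_translate (fun x => |f (x + d) - f x|) d
    simp_rw [add_assoc, ← two_nsmul] at this
    rw [expect_sub_distrib, expect_add_distrib, this, ← mul_expect]
    ring
  simp_rw [h2, mul_sub, expect_sub_distrib, ← expect_mul]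
  rw [hW.expect_eq_one, one_mul, mul_expect]
  congr 1
  exact expect_congr rfl fun d _ => by ring

lemma weightedAP_telescope (W f g : G → ℝ) :
    weightedAP W f f f - weightedAP W g g g = weightedAP W (fun x => f x - g x) f f +
      weightedAP W g (fun x => f x - g x) f + weightedAP W g g (fun x => f x - g x) := by
  simp_rw [weightedAP, ← expect_sub_distrib, ← expect_add_distrib, ← mul_sub, ← mul_add,
    ← expect_sub_distrib, ← expect_add_distrib]
  refine expect_congr rfl fun d _ => ?_
  congr 1
  exact expect_congr rfl fun x _ => by ring

lemma weightedAP_sub_le_of_fourierCoef (hG : Odd (Fintype.card G)) {W : G → ℝ}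
    {w : AddChar G ℂ → ℝ} (hW : IsFourierKernel W w) {f g : G → ℝ}
    (hf : ∀ x, f x ∈ Set.Icc (0 : ℝ) 1) (hg : ∀ x, g x ∈ Set.Icc (0 : ℝ) 1) {η : ℝ} (hη : 0 ≤ η)
    (H : ∀ ψ, ‖fourierCoef (fun x => (f x : ℂ)) ψ - fourierCoef (fun x => (g x : ℂ)) ψ‖ ≤ η) :
    weightedAP W g g g - 3 * (W 0 * η) ≤ weightedAP W f f f := by
  have hf' : ∀ x, |f x| ≤ 1 := fun x => abs_le.2 ⟨by linarith [(hf x).1], (hf x).2⟩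
  have hg' : ∀ x, |g x| ≤ 1 := fun x => abs_le.2 ⟨by linarith [(hg x).1], (hg x).2⟩
  have hfg : ∀ x, |f x - g x| ≤ 1 := fun x =>
    abs_le.2 ⟨by linarith [(hf x).1, (hg x).2], by linarith [(hf x).2, (hg x).1]⟩
  have H' : ∀ ψ, ‖fourierCoef (fun x => ((f x - g x : ℝ) : ℂ)) ψ‖ ≤ η := by
    intro ψ
    simp_rw [Complex.ofReal_sub, fourierCoef_sub (fun x => (f x : ℂ))]
    exact H ψ
  have e := weightedAP_telescope W f g
  have h1 := abs_le.1 (abs_weightedAP_le hG hW hη hfg hf' hf' (Or.inl H'))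
  have h2 := abs_le.1 (abs_weightedAP_le hG hW hη hg' hfg hf' (Or.inr (Or.inl H')))
  have h3 := abs_le.1 (abs_weightedAP_le hG hW hη hg' hg' hfg (Or.inr (Or.inr H')))
  linarith [h1.1, h2.1, h3.1]

/-- Linearised Cauchy–Schwarz: averaging this turns an L² bound `t ^ 2` into an L¹ bound `t`. -/
lemma abs_le_of_sq {t : ℝ} (ht : 0 < t) (u : ℝ) : |u| ≤ (u ^ 2 / t + t) / 2 := by
  rw [le_div_iff₀ two_pos, ← sub_nonneg]
  have : u ^ 2 / t + t - |u| * 2 = (|u| - t) ^ 2 / t := by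
    rw [← sq_abs u]
    field_simp
    ring
  rw [this]
  positivity

lemma expect_mul_expect_abs_le {W : G → ℝ} {w : AddChar G ℂ → ℝ} (hW : IsFourierKernel W w)
    {u : G → G → ℝ} {t : ℝ} (ht : 0 < t) (h : 𝔼 d, W d * 𝔼 x, u d x ^ 2 ≤ t ^ 2) :
    𝔼 d, W d * 𝔼 x, |u d x| ≤ t := by
  refine (expect_mul_expect_mono hW.nonneg fun d x => abs_le_of_sq ht (u d x)).trans ?_
  have e : 𝔼 d, W d * 𝔼 x, (u d x ^ 2 / t + t) / 2 =
      ((𝔼 d, W d * 𝔼 x, u d x ^ 2) / t + t) / 2 := by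
    simp_rw [← expect_div, expect_add_distrib, ← expect_div, Fintype.expect_const]
    have : ∀ d, W d * (((𝔼 x, u d x ^ 2) / t + t) / 2) =
        (W d * 𝔼 x, u d x ^ 2) / t / 2 + W d * (t / 2) := fun d => by ring
    simp_rw [this, expect_add_distrib, ← expect_mul, ← expect_div, hW.expect_eq_one]
    ring
  rw [e]
  have : (𝔼 d, W d * 𝔼 x, u d x ^ 2) / t ≤ t := by
    rw [div_le_iff₀ ht]
    linarith
  linarith

lemma expect_abs_le {u : G → ℝ} {t : ℝ} (ht : 0 < t) (h : 𝔼 x, u x ^ 2 ≤ t ^ 2) :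
    𝔼 x, |u x| ≤ t := by
  classical
  have := expect_mul_expect_abs_le (isFourierKernel_one (G := G)) (u := fun _ x => u x) ht
    (by simpa using h)
  simpa using this

lemma cube_expect_le {f : G → ℝ} (hf : ∀ x, 0 ≤ f x) : (𝔼 x, f x) ^ 3 ≤ 𝔼 x, f x ^ 3 := by
  set m := 𝔼 x, f x with hm
  have hm0 : 0 ≤ m := expect_nonneg fun x _ => hf x
  have h : 𝔼 x, (3 * m ^ 2 * f x - 2 * m ^ 3) ≤ 𝔼 x, f x ^ 3 := by
    refine expect_le_expect fun x _ => ?_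
    -- Tangent line at the mean: y³ - 3m²y + 2m³ = (y - m)²(y + 2m).
    nlinarith [mul_nonneg (sq_nonneg (f x - m)) (add_nonneg (hf x) (mul_nonneg zero_le_two hm0))]
  rw [expect_sub_distrib, ← mul_expect, ← hm, Fintype.expect_const] at h
  linarith

lemma expectConv_mem_Icc {f β : G → ℝ} {b : AddChar G ℂ → ℝ} (hβ : IsFourierKernel β b)
    (hf : ∀ x, f x ∈ Set.Icc (0 : ℝ) 1) (x : G) : expectConv f β x ∈ Set.Icc (0 : ℝ) 1 := by
  refine ⟨expect_nonneg fun y _ => mul_nonneg (hf _).1 (hβ.nonneg y), ?_⟩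
  rw [← hβ.expect_eq_one]
  exact expect_le_expect fun y _ => mul_le_of_le_one_left (hβ.nonneg y) (hf _).2

lemma expect_expectConv {f β : G → ℝ} {b : AddChar G ℂ → ℝ} (hβ : IsFourierKernel β b) :
    𝔼 x, expectConv f β x = 𝔼 x, f x := by
  simp_rw [expectConv]
  rw [expect_comm]
  simp_rw [← expect_mul]
  have : ∀ y, 𝔼 x, f (x - y) = 𝔼 x, f x := fun y => by
    simpa only [sub_eq_add_neg] using expect_translate f (-y)
  simp_rw [this, ← mul_expect, hβ.expect_eq_one, mul_one]

lemma expect_sq_sub_expectConv {f β β' : G → ℝ} {b b' : AddChar G ℂ → ℝ}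
    (hβ : IsFourierKernel β b) (hβ' : IsFourierKernel β' b') :
    𝔼 x, (expectConv f β' x - expectConv f β x) ^ 2 =
      ∑ ψ, ‖fourierCoef (fun x => (f x : ℂ)) ψ‖ ^ 2 * (b' ψ - b ψ) ^ 2 := by
  have h := sum_norm_sq_fourierCoef
    (fun x => (expectConv f β' x : ℂ) - (expectConv f β x : ℂ))
  simp_rw [fourierCoef_sub (fun x => (expectConv f β' x : ℂ)), fourierCoef_expectConv,
    hβ.fourierCoef_eq, hβ'.fourierCoef_eq, ← mul_sub, ← Complex.ofReal_sub, norm_mul, mul_pow,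
    Complex.norm_real, Real.norm_eq_abs, sq_abs] at h
  exact h.symm

/-- Parseval for each d, after which averaging |1 - ψ(d)|² against `W` gives 2(1 - w(ψ)). -/
lemma expect_sq_translate_expectConv {f W β : G → ℝ} {w b : AddChar G ℂ → ℝ}
    (hW : IsFourierKernel W w) (hβ : IsFourierKernel β b) :
    𝔼 d, W d * 𝔼 x, (expectConv f β (x + d) - expectConv f β x) ^ 2 =
      ∑ ψ, ‖fourierCoef (fun x => (f x : ℂ)) ψ‖ ^ 2 * (2 * (b ψ ^ 2 * (1 - w ψ))) := by
  have h : ∀ d, 𝔼 x, (expectConv f β (x + d) - expectConv f β x) ^ 2 =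
      ∑ ψ, ‖fourierCoef (fun x => (f x : ℂ)) ψ‖ ^ 2 * b ψ ^ 2 * ‖1 - ψ d‖ ^ 2 := by
    intro d
    have h := sum_norm_sq_fourierCoef
      (fun x => (expectConv f β (x + d) : ℂ) - (expectConv f β x : ℂ))
    simp_rw [fourierCoef_sub (fun x => (expectConv f β (x + d) : ℂ)),
      fourierCoef_translate (fun x => (expectConv f β x : ℂ)), fourierCoef_expectConv,
      hβ.fourierCoef_eq, ← Complex.ofReal_sub, Complex.norm_real, Real.norm_eq_abs, sq_abs] at h
    rw [← h]
    refine sum_congr rfl fun ψ _ => ?_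
    rw [← mul_sub_one, norm_mul, norm_mul, norm_sub_rev, mul_pow, mul_pow, Complex.norm_real,
      Real.norm_eq_abs, sq_abs]
  simp_rw [h, mul_sum, expect_sum_comm]
  refine sum_congr rfl fun ψ _ => ?_
  have e := expect_mul_norm_one_sub_sq W ψ
  rw [hW.fourierCoef_eq, hW.expect_eq_one, Complex.ofReal_re] at e
  simp_rw [mul_left_comm (W _)]
  rw [← mul_expect, e]
  ring

/-- The weighted number of progressions is almost as large as for a random function, given
kernels at three scales that are compatible with one another and with `f`. -/
lemma cube_expect_sub_le_weightedAP (hG : Odd (Fintype.card G)) {f β W β' : G → ℝ}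
    {b w b' : AddChar G ℂ → ℝ} (hβ : IsFourierKernel β b) (hW : IsFourierKernel W w)
    (hβ' : IsFourierKernel β' b') (hf : ∀ x, f x ∈ Set.Icc (0 : ℝ) 1) {t η : ℝ} (ht : 0 < t)
    (hη : 0 ≤ η) (hbb' : ∑ ψ, ‖fourierCoef (fun x => (f x : ℂ)) ψ‖ ^ 2 * (b' ψ - b ψ) ^ 2 ≤ t ^ 2)
    (hbw : ∀ ψ, 2 * (b ψ ^ 2 * (1 - w ψ)) ≤ t ^ 2)
    (hfb' : ∀ ψ, ‖fourierCoef (fun x => (f x : ℂ)) ψ‖ * (1 - b' ψ) ≤ η) (hWη : W 0 * η ≤ t) :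
    (𝔼 x, f x) ^ 3 - 9 * t ≤ weightedAP W f f f := by
  have hnorm : ∀ x, ‖(f x : ℂ)‖ ≤ 1 := fun x => by
    rw [Complex.norm_of_nonneg (hf x).1]
    exact (hf x).2
  have m := expectConv_mem_Icc hβ hf
  have m' := expectConv_mem_Icc hβ' hf
  have h1 := weightedAP_sub_le_of_fourierCoef hG hW hf m' hη fun ψ => by
    rw [fourierCoef_expectConv, hβ'.fourierCoef_eq, ← mul_one_sub, norm_mul,
      ← Complex.ofReal_one, ← Complex.ofReal_sub,
      Complex.norm_of_nonneg (sub_nonneg.2 (hβ'.coef_le_one ψ))]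
    exact hfb' ψ
  have h2 := weightedAP_sub_le_of_L1 hW m m'
  have h3 := le_weightedAP_of_translate hW m
  have h4 := cube_expect_le fun x => (m x).1
  rw [expect_expectConv hβ] at h4
  have h5 := expect_abs_le ht ((expect_sq_sub_expectConv (f := f) hβ hβ').trans_le hbb')
  have h6 := expect_mul_expect_abs_le hW ht
    ((expect_sq_translate_expectConv (f := f) hW hβ).trans_le (by
      calc _ ≤ ∑ ψ, ‖fourierCoef (fun x => (f x : ℂ)) ψ‖ ^ 2 * t ^ 2 :=
            sum_le_sum fun ψ _ => mul_le_mul_of_nonneg_left (hbw ψ) (sq_nonneg _)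
        _ ≤ 1 * t ^ 2 := by
            rw [← sum_mul]
            gcongr
            exact sum_norm_sq_fourierCoef_le_one hnorm
        _ = t ^ 2 := one_mul _))
  -- Each of the comparisons `h1`, `h2`, `h3` costs at most `3 * t`.
  linarith

end ThreeAP

/-! ### Choice of scales by energy increment -/

section Scales

/-- The bound at `0` for the kernel at the scale following a kernel bounded by `M` at `0`. -/
noncomputable def nextKernelBound (δ M : ℝ) : ℝ :=
  (⌈2 * M / δ⌉₊ : ℝ) ^ (2 * ⌈M / δ + (M / δ) ^ 2⌉₊)

/-- Bounds at `0` for a sequence of kernels at successive scales. -/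
noncomputable def kernelBound (δ : ℝ) : ℕ → ℝ
  | 0 => 1
  | n + 1 => nextKernelBound δ (kernelBound δ n)

lemma one_le_kernelBound {δ : ℝ} (hδ : 0 < δ) (n : ℕ) : 1 ≤ kernelBound δ n := by
  induction n with
  | zero => exact le_rfl
  | succ n ih =>
    refine one_le_pow₀ ?_
    have : 0 < ⌈2 * kernelBound δ n / δ⌉₊ := Nat.ceil_pos.2 (by positivity)
    exact_mod_cast this

variable {G : Type*} [AddCommGroup G] [Fintype G]

lemma card_filter_mul_le {ι : Type*} [Fintype ι] {u : ι → ℝ} (hu : ∀ i, 0 ≤ u i) (c : ℝ)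
    [DecidablePred fun i => c ≤ u i] : (#{i | c ≤ u i} : ℝ) * c ≤ ∑ i, u i := by
  rw [← nsmul_eq_mul]
  exact (card_nsmul_le_sum _ _ _ fun i hi => (mem_filter.1 hi).2).trans
    (sum_le_sum_of_subset_of_nonneg (subset_univ _) fun i _ _ => hu i)

lemma exists_next_isFourierKernel {δ M : ℝ} (hδ : 0 < δ) (hM : 1 ≤ M) {f : G → ℂ}
    (hf : ∀ x, ‖f x‖ ≤ 1) {β : G → ℝ} {b : AddChar G ℂ → ℝ} (hβ : IsFourierKernel β b)
    (hβM : β 0 ≤ M) :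
    ∃ (β' : G → ℝ) (b' : AddChar G ℂ → ℝ), IsFourierKernel β' b' ∧ β' 0 ≤ nextKernelBound δ M ∧
      (∀ ψ, δ ≤ b ψ → 1 - δ ≤ b' ψ) ∧ ∀ ψ, ‖fourierCoef f ψ‖ * (1 - b' ψ) ≤ δ / M := by
  classical
  have hM0 : 0 < M := by linarith
  set L := ⌈2 * M / δ⌉₊ with hL
  have hL1 : 1 ≤ L := Nat.ceil_pos.2 (by positivity)
  have hL0 : (0 : ℝ) < L := by exact_mod_cast hL1
  have hL2 : 2 / (L : ℝ) ≤ δ / M := by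
    have : 2 * M / δ ≤ L := Nat.le_ceil _
    rw [div_le_iff₀ hδ] at this
    rw [div_le_div_iff₀ hL0 hM0]
    linarith
  have hδM : δ / M ≤ δ := div_le_self hδ.le hM
  -- The new kernel must nearly fix the characters that matter to the old kernel or to f. The first
  -- kind number at most M/δ because the b(ψ) sum to β(0), the second at most (M/δ)² by Parseval, so
  -- the bound on `S` is independent of `G`.
  set S : Finset (AddChar G ℂ) := {ψ | δ ≤ b ψ ∨ δ / M ≤ ‖fourierCoef f ψ‖} with hS
  have hcard : #S ≤ ⌈M / δ + (M / δ) ^ 2⌉₊ := by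
    have h1 : (#{ψ | δ ≤ b ψ} : ℝ) ≤ M / δ := by
      rw [le_div_iff₀ hδ]
      exact (card_filter_mul_le hβ.coef_nonneg δ).trans (hβ.sum_coef.trans_le hβM)
    have h2 : (#{ψ | (δ / M) ^ 2 ≤ ‖fourierCoef f ψ‖ ^ 2} : ℝ) ≤ (M / δ) ^ 2 := by
      have := (card_filter_mul_le (fun ψ => sq_nonneg ‖fourierCoef f ψ‖) ((δ / M) ^ 2)).trans
        (sum_norm_sq_fourierCoef_le_one hf)
      rw [← le_div_iff₀ (by positivity)] at this
      refine this.trans_eq ?_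
      field_simp
    have h3 : #S ≤ #{ψ | δ ≤ b ψ} + #{ψ | (δ / M) ^ 2 ≤ ‖fourierCoef f ψ‖ ^ 2} := by
      refine (card_le_card fun ψ hψ => ?_).trans (card_union_le _ _)
      simp only [hS, mem_union, mem_filter, mem_univ, true_and] at hψ ⊢
      exact hψ.imp_right fun h => pow_le_pow_left₀ (by positivity) h 2
    have h4 : (#S : ℝ) ≤ ⌈M / δ + (M / δ) ^ 2⌉₊ := by
      refine le_trans ?_ (Nat.le_ceil _)
      have : (#S : ℝ) ≤ #{ψ | δ ≤ b ψ} + #{ψ | (δ / M) ^ 2 ≤ ‖fourierCoef f ψ‖ ^ 2} := by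
        exact_mod_cast h3
      linarith
    exact_mod_cast h4
  obtain ⟨β', b', hβ', h0, hb'⟩ := exists_isFourierKernel hL1 S
  refine ⟨β', b', hβ', h0.trans ?_, ?_, ?_⟩
  · exact pow_le_pow_right₀ (by exact_mod_cast hL1) (by omega)
  · intro ψ hψ
    have := hb' ψ (by simp [hS, hψ])
    linarith
  · intro ψ
    have h1 := hβ'.coef_le_one ψ
    have h2 := hβ'.coef_nonneg ψ
    by_cases hψ : ψ ∈ S
    · have h3 := hb' ψ hψ
      exact (mul_le_of_le_one_left (by linarith) (norm_fourierCoef_le_one hf ψ)).trans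
        (by linarith)
    · have h3 : ‖fourierCoef f ψ‖ < δ / M := by
        simp only [hS, mem_filter, mem_univ, true_and, not_or, not_le] at hψ
        exact hψ.2
      exact (mul_le_of_le_one_right (norm_nonneg _) (by linarith)).trans h3.le

lemma exists_seq_isFourierKernel {δ : ℝ} (hδ : 0 < δ) {f : G → ℂ} (hf : ∀ x, ‖f x‖ ≤ 1) :
    ∃ (β : ℕ → G → ℝ) (b : ℕ → AddChar G ℂ → ℝ), ∀ n, IsFourierKernel (β n) (b n) ∧
      β n 0 ≤ kernelBound δ n ∧ (∀ ψ, δ ≤ b n ψ → 1 - δ ≤ b (n + 1) ψ) ∧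
      ∀ ψ, ‖fourierCoef f ψ‖ * (1 - b (n + 1) ψ) ≤ δ / kernelBound δ n := by
  classical
  let P : ℕ → Type _ := fun n => {p : (G → ℝ) × (AddChar G ℂ → ℝ) //
    IsFourierKernel p.1 p.2 ∧ p.1 0 ≤ kernelBound δ n}
  have step : ∀ n (p : P n), ∃ q : P (n + 1), (∀ ψ, δ ≤ p.1.2 ψ → 1 - δ ≤ q.1.2 ψ) ∧
      ∀ ψ, ‖fourierCoef f ψ‖ * (1 - q.1.2 ψ) ≤ δ / kernelBound δ n := by
    rintro n ⟨⟨β, b⟩, hβ, hM⟩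
    obtain ⟨β', b', h1, h2, h3⟩ :=
      exists_next_isFourierKernel hδ (one_le_kernelBound hδ n) hf hβ hM
    exact ⟨⟨⟨β', b'⟩, h1, h2⟩, h3⟩
  choose next hnext using step
  let s : ∀ n, P n := fun n =>
    Nat.rec ⟨⟨fun _ => 1, _⟩, isFourierKernel_one, le_rfl⟩ (fun n p => next n p) n
  exact ⟨fun n => (s n).1.1, fun n => (s n).1.2, fun n =>
    ⟨(s n).2.1, (s n).2.2, (hnext n (s n)).1, (hnext n (s n)).2⟩⟩

/-- The difference y² - x² - (y - x)² equals 2x(y - x), which is at least -2c. -/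
lemma sq_sub_le_of_sub_le {x y c : ℝ} (hx0 : 0 ≤ x) (hx1 : x ≤ 1) (hc : 0 ≤ c) (h : x - c ≤ y) :
    (y - x) ^ 2 ≤ y ^ 2 - x ^ 2 + 2 * c := by
  nlinarith

/-- Energy increment: along an almost increasing sequence of multipliers with values in `[0, 1]`,
two consecutive even terms are close in the weighted `L²` sense. -/
lemma exists_sum_mul_sq_sub_le {ι : Type*} [Fintype ι] {c : ι → ℝ} (hc : ∀ i, 0 ≤ c i)
    (hc1 : ∑ i, c i ≤ 1) {b : ℕ → ι → ℝ} (hb0 : ∀ n i, 0 ≤ b n i) (hb1 : ∀ n i, b n i ≤ 1)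
    {δ s : ℝ} (hδ : 0 ≤ δ) (hb : ∀ n i, b n i - δ ≤ b (n + 1) i) (hs : 8 * δ ≤ s) {K : ℕ}
    (hK : 2 < K * s) :
    ∃ k < K, ∑ i, c i * (b (2 * k + 2) i - b (2 * k) i) ^ 2 ≤ s := by
  by_contra! hcon
  -- Each failure raises the energy by at least s - 4δ ≥ s/2, and the energy never exceeds 1. Steps
  -- of length two leave an odd-indexed scale in between, later used for the weight.
  have hstep : ∀ k < K, ∑ i, c i * b (2 * k) i ^ 2 + s / 2 ≤ ∑ i, c i * b (2 * (k + 1)) i ^ 2 := by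
    intro k hk
    have h1 := hcon k hk
    have h2 : ∑ i, c i * (b (2 * k + 2) i - b (2 * k) i) ^ 2 ≤
        ∑ i, (c i * b (2 * (k + 1)) i ^ 2 - c i * b (2 * k) i ^ 2 + c i * (4 * δ)) := by
      refine sum_le_sum fun i _ => ?_
      rw [← mul_sub, ← mul_add]
      refine mul_le_mul_of_nonneg_left ?_ (hc i)
      have := sq_sub_le_of_sub_le (y := b (2 * k + 2) i) (c := 2 * δ) (hb0 (2 * k) i)
        (hb1 (2 * k) i) (by linarith) (by linarith [hb (2 * k) i, hb (2 * k + 1) i])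
      rw [show 2 * (k + 1) = 2 * k + 2 by ring]
      linarith
    rw [sum_add_distrib, sum_sub_distrib, ← sum_mul] at h2
    nlinarith
  have hind : ∀ k ≤ K, k * (s / 2) ≤ ∑ i, c i * b (2 * k) i ^ 2 := by
    intro k
    induction k with
    | zero =>
      intro _
      simpa using sum_nonneg fun i _ => mul_nonneg (hc i) (sq_nonneg (b (2 * 0) i))
    | succ k ih =>
      intro hk
      have := hstep k hk
      have := ih (by omega)
      push_cast
      linarith
  have h1 := hind K le_rfl
  have h2 : ∑ i, c i * b (2 * K) i ^ 2 ≤ ∑ i, c i :=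
    sum_le_sum fun i _ => mul_le_of_le_one_right (hc i) (pow_le_one₀ (hb0 _ i) (hb1 _ i))
  linarith

/-- There is a probability density on `G`, bounded at `0` independently of `G`, with respect to
which the weighted number of three-term progressions is at least roughly the random one. -/
lemma exists_weight_cube_sub_le_weightedAP {t : ℝ} (ht : 0 < t) (ht1 : t ≤ 1) {K : ℕ}
    (hK : 2 < K * t ^ 2) (hG : Odd (Fintype.card G)) {f : G → ℝ}
    (hf : ∀ x, f x ∈ Set.Icc (0 : ℝ) 1) :
    ∃ W : G → ℝ, (∀ d, 0 ≤ W d) ∧ 𝔼 d, W d = 1 ∧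
      W 0 ≤ ∑ n ∈ range (2 * K), kernelBound (t ^ 2 / 8) n ∧
      (𝔼 x, f x) ^ 3 - 9 * t ≤ weightedAP W f f f := by
  set δ := t ^ 2 / 8 with hδdef
  have hδ : 0 < δ := by positivity
  have hnorm : ∀ x, ‖(f x : ℂ)‖ ≤ 1 := fun x => by
    rw [Complex.norm_of_nonneg (hf x).1]
    exact (hf x).2
  obtain ⟨β, b, h⟩ := exists_seq_isFourierKernel hδ hnorm
  have hmono : ∀ n ψ, b n ψ - δ ≤ b (n + 1) ψ := by
    intro n ψ
    rcases le_or_gt δ (b n ψ) with h' | h'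
    · linarith [(h n).2.2.1 ψ h', (h n).1.coef_le_one ψ]
    · linarith [(h (n + 1)).1.coef_nonneg ψ]
  obtain ⟨k, hk, hsum⟩ := exists_sum_mul_sq_sub_le (fun ψ => sq_nonneg _)
    (sum_norm_sq_fourierCoef_le_one hnorm) (fun n => (h n).1.coef_nonneg)
    (fun n => (h n).1.coef_le_one) hδ.le hmono (s := t ^ 2) (by linarith) hK
  have hW := (h (2 * k + 1)).1
  have hMpos : ∀ n, 0 < kernelBound δ n := fun n => by linarith [one_le_kernelBound hδ n]
  -- The index k depends on `G` and f, so `W 0` is bounded by the sum over all admissible scales.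
  -- The tolerance η is δ divided by the bound for `W 0`.
  refine ⟨β (2 * k + 1), hW.nonneg, hW.expect_eq_one, (h (2 * k + 1)).2.1.trans
    (single_le_sum (fun n _ => (hMpos n).le) (mem_range.2 (by omega))),
    cube_expect_sub_le_weightedAP hG (h (2 * k)).1 hW (h (2 * k + 2)).1 hf ht
      (div_nonneg hδ.le (hMpos (2 * k + 1)).le) hsum ?_ (h (2 * k + 1)).2.2.2 ?_⟩
  · intro ψ
    have hb0 := (h (2 * k)).1.coef_nonneg ψ
    have hb1 := (h (2 * k)).1.coef_le_one ψ
    have hw0 := hW.coef_nonneg ψ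
    have hw1 := hW.coef_le_one ψ
    rcases le_or_gt δ (b (2 * k) ψ) with h' | h'
    · have h1 := (h (2 * k)).2.2.1 ψ h'
      have h2 : b (2 * k) ψ ^ 2 ≤ 1 := pow_le_one₀ hb0 hb1
      nlinarith
    · have h2 : b (2 * k) ψ ^ 2 ≤ δ := by nlinarith
      nlinarith
  · rw [← mul_div_assoc, div_le_iff₀ (hMpos _), mul_comm]
    have h1 := (h (2 * k + 1)).2.1
    have h2 : δ ≤ t := by nlinarith
    exact mul_le_mul h2 h1 (hW.nonneg 0) ht.le

lemma weightedAP_indicator [DecidableEq G] (W : G → ℝ) (A : Finset G) :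
    weightedAP W (fun x => if x ∈ A then 1 else 0) (fun x => if x ∈ A then 1 else 0)
      (fun x => if x ∈ A then 1 else 0) =
      𝔼 d, W d * ((numThreeAP A d : ℝ) / Fintype.card G) := by
  refine expect_congr rfl fun d _ => ?_
  rw [Fintype.expect_eq_sum_div_card, numThreeAP, card_filter]
  congr 2
  push_cast
  rw [← sum_filter_add_sum_filter_not univ (· ∈ A)]
  simp only [filter_univ_mem]
  rw [sum_eq_zero (s := {x | x ∉ A}) fun x hx => by simp [(mem_filter.1 hx).2], add_zero]
  refine sum_congr rfl fun x hx => ?_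
  by_cases h1 : x + d ∈ A <;> simp [hx, h1]

end Scales

theorem theorem1p8 (α ε : ℝ) (hα : 0 < α) (hε : 0 < ε) :
    ∃ N₀ : ℕ, ∀ (G : Type*) [AddCommGroup G] [Fintype G] [DecidableEq G],
      N₀ < Fintype.card G → Odd (Fintype.card G) →
      ∀ A : Finset G, (A.card : ℝ) = α * (Fintype.card G : ℝ) →
        ∃ d : G, d ≠ 0 ∧
          (α ^ 3 - ε) * (Fintype.card G : ℝ) ≤ (numThreeAP A d : ℝ) := by
  -- The total loss `9 * t` is then at most ε/2; the other half of ε pays for d = 0.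
  set t : ℝ := min 1 (ε / 18) with htdef
  have ht : 0 < t := by positivity
  obtain ⟨K, hK⟩ := exists_nat_gt (2 / t ^ 2)
  rw [div_lt_iff₀ (by positivity)] at hK
  set B : ℝ := ∑ n ∈ range (2 * K), kernelBound (t ^ 2 / 8) n with hB
  -- The ceiling makes `B`/N < ε/2; the extra 1 forces N > 1, so a nonzero difference exists.
  refine ⟨⌈2 * B / ε⌉₊ + 1, fun G _ _ _ hN hG A hA => ?_⟩
  have hNB : 2 * B / ε < Fintype.card G :=
    (Nat.le_ceil _).trans_lt (by exact_mod_cast (by omega : ⌈2 * B / ε⌉₊ < Fintype.card G))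
  have hN0 : (0 : ℝ) < Fintype.card G := by exact_mod_cast (by omega : 0 < Fintype.card G)
  by_contra! hcon
  obtain ⟨W, hW0, hW1, hWB, hAP⟩ := exists_weight_cube_sub_le_weightedAP (G := G) ht
    (min_le_left _ _) hK hG (f := fun x => if x ∈ A then 1 else 0)
    (fun x => by split_ifs <;> simp)
  have hmean : 𝔼 x, (if x ∈ A then (1 : ℝ) else 0) = α := by
    rw [Fintype.expect_eq_sum_div_card, div_eq_iff hN0.ne', ← hA]
    simp
  rw [hmean, weightedAP_indicator] at hAP
  have : Nontrivial G := Fintype.one_lt_card_iff_nontrivial.1 (by omega)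
  obtain ⟨d₀, hd₀⟩ := exists_ne (0 : G)
  -- Nonnegativity lets the term d = 0 also be charged `W d * (α ^ 3 - ε)`, with the whole of `W 0`
  -- added as the error.
  have hpos : 0 ≤ α ^ 3 - ε := by
    have h := (Nat.cast_nonneg (α := ℝ) (numThreeAP A d₀)).trans (hcon d₀ hd₀).le
    exact nonneg_of_mul_nonneg_left h hN0
  have hle : 𝔼 d, W d * ((numThreeAP A d : ℝ) / Fintype.card G) ≤
      𝔼 d, (W d * (α ^ 3 - ε) + if d = 0 then W d else 0) := by
    refine expect_le_expect fun d _ => ?_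
    by_cases hd : d = 0
    · have h1 : (numThreeAP A d : ℝ) / Fintype.card G ≤ 1 := by
        rw [div_le_one hN0]
        exact_mod_cast card_le_univ _
      rw [if_pos hd]
      nlinarith [hW0 d]
    · rw [if_neg hd, add_zero]
      exact mul_le_mul_of_nonneg_left ((div_le_iff₀ hN0).2 (hcon d hd).le) (hW0 d)
  rw [expect_add_distrib, ← expect_mul, hW1, one_mul,
    Fintype.expect_eq_sum_div_card (fun d => if d = 0 then W d else 0),
    sum_ite_eq' univ (0 : G) W, if_pos (mem_univ _)] at hle
  have h9 : 9 * t ≤ ε / 2 := by linarith [min_le_right 1 (ε / 18)]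
  have hlt : W 0 / Fintype.card G < ε / 2 := by
    rw [div_lt_iff₀ hε] at hNB
    rw [div_lt_iff₀ hN0]
    linarith
  linarith
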